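/- Let $d \ge 0$ be an integer, $E = \mathbb{Q}^2$, and let $\sigma_d : \mathbb{Q}\,\mathrm{GL}_2(\mathbb{Q}) \to \operatorname{End}_{\mathbb{Q}}(E^{\otimes d})$ be the linear extension of the diagonal action $g(v_1\otimes\cdots\otimes v_d) = gv_1\otimes\cdots\otimes gv_d$. The Schur algebra $S(2,d)$ over $\mathbb{Q}$ is the image of $\sigma_d$. Let $\rho_d : \mathfrak{gl}_2(\mathbb{Q}) \to \operatorname{End}_{\mathbb{Q}}(E^{\otimes d})$ be the differential of $\sigma_d$, $\rho_d(x) = \sum_{i=1}^d 1\otimes\cdots\otimes x\otimes\cdots\otimes 1$ ($x$ in position $i$), and let $e_{ij}$ denote the matrix units of $\mathfrak{gl}_2(\mathbb{Q})$. (1) $S(2,d)$ is isomorphic to the associative unital $\mathbb{Q}$-algebra generated by $e, f, H_1$ subject to the relations $$H_1e - eH_1 = e,\qquad ef - fe = 2H_1 - d,\qquad H_1f - fH_1 = -f,\qquad H_1(H_1-1)\cdots(H_1-d) = 0,$$ by an isomorphism that sends $e, f, H_1$ to $\rho_d(e_{12}), \rho_d(e_{21}), \rho_d(e_{11})$ respectively.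 The monomials $e^aH_1^bf^c$ with $a,b,c\ge 0$ and $a+b+c\le d$ form a $\mathbb{Q}$-basis of this algebra. (2) Let $\mathcal{B}_d$ be the associative unital $\mathbb{Q}$-algebra generated by $e, f, H_1, H_2$ subject to the relations $$H_1H_2 = H_2H_1,\quad H_1e - eH_1 = e,\quad H_1f - fH_1 = -f,\quad H_2e - eH_2 = -e,\quad H_2f - fH_2 = f,\quad ef - fe = H_1 - H_2,$$ $$H_1 + H_2 = d,\qquad H_1(H_1-1)\cdots(H_1-d) = 0.$$ Then $S(2,d)$ is isomorphic to $\mathcal{B}_d$, by an isomorphism $\mathcal{B}_d \to S(2,d)$ that sends $e, f, H_1, H_2$ to $\rho_d(e_{12}), \rho_d(e_{21}), \rho_d(e_{11}), \rho_d(e_{22})$ respectively. The monomials $e^aH_1^bf^c$ with $a+b+c\le d$ form a $\mathbb{Q}$-basis of $\mathcal{B}_d$, as do the monomials $f^aH_2^be^c$ with $a+b+c\le d$; and the corresponding monomials in the elements $\rho_d(e_{12}), \rho_d(e_{21}), \rho_d(e_{11}), \rho_d(e_{22})$ form two $\mathbb{Q}$-bases of $S(2,d)$. -/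

import Mathlib

namespace SchurTwo

noncomputable section

open scoped TensorProduct

/-- The natural two-dimensional module `E = ℚ²`. -/
abbrev E : Type := Fin 2 → ℚ

/-- Tensor space `E^{⊗ d}`. -/
abbrev TensorSpace (d : ℕ) : Type := ⨂[ℚ] _ : Fin d, E

/-- Mathlib's additive group structure on tensor space, recorded as a shortcut so that ring lemmas
about `Module.End ℚ (TensorSpace d)` unify. -/
instance instAddCommGroupTensorSpace (d : ℕ) : AddCommGroup (TensorSpace d) :=
  PiTensorProduct.instAddCommGroup

/-- The diagonal representation `σ_d` of `GL₂(ℚ)` on `E^{⊗ d}`: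
`g (v₁ ⊗ ⋯ ⊗ v_d) = g v₁ ⊗ ⋯ ⊗ g v_d`. -/
def sigma (d : ℕ) : Representation ℚ (Matrix.GeneralLinearGroup (Fin 2) ℚ) (TensorSpace d) where
  toFun g := PiTensorProduct.map fun _ : Fin d => Matrix.toLin' (g : Matrix (Fin 2) (Fin 2) ℚ)
  map_one' := by
    simp only [Units.val_one, Matrix.toLin'_one]
    exact PiTensorProduct.map_id
  map_mul' g h := by
    simp only [Units.val_mul, Matrix.toLin'_mul]
    exact PiTensorProduct.map_comp _ _

/-- The Schur algebra `S(2,d)` over `ℚ`: the image of the group algebra `ℚ GL₂(ℚ)` in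
`End(E^{⊗ d})`. -/
def schurAlgebra (d : ℕ) : Subalgebra ℚ (Module.End ℚ (TensorSpace d)) :=
  (sigma d).asAlgebraHom.range

/-- The operator `1 ⊗ ⋯ ⊗ A ⊗ ⋯ ⊗ 1` on `E^{⊗ d}`, with `A` in position `i`. -/
def place (d : ℕ) (i : Fin d) : Module.End ℚ E →ₗ[ℚ] Module.End ℚ (TensorSpace d) :=
  (PiTensorProduct.mapMultilinear ℚ (fun _ : Fin d => E) (fun _ : Fin d => E)).toLinearMap
    (fun _ => LinearMap.id) i

theorem place_apply (d : ℕ) (i : Fin d) (A : Module.End ℚ E) :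
    place d i A = PiTensorProduct.mapMonoidHom (Pi.mulSingle i A) := rfl

theorem place_mul (d : ℕ) (i : Fin d) (A B : Module.End ℚ E) :
    place d i (A * B) = place d i A * place d i B := by
  simp only [place_apply, Pi.mulSingle_mul, map_mul]

theorem place_commute (d : ℕ) {i j : Fin d} (h : i ≠ j) (A B : Module.End ℚ E) :
    Commute (place d i A) (place d j B) := by
  simp only [place_apply]
  exact (Pi.mulSingle_commute (f := fun _ : Fin d => Module.End ℚ E) h A B).map _

/-- The representation `ρ_d` of the Lie algebra `𝔤𝔩₂(ℚ)` on `E^{⊗ d}`, the derivative of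
`σ_d`: `x` acts as `∑ᵢ 1 ⊗ ⋯ ⊗ x ⊗ ⋯ ⊗ 1`. -/
def rho (d : ℕ) : Matrix (Fin 2) (Fin 2) ℚ →ₗ[ℚ] Module.End ℚ (TensorSpace d) :=
  ∑ i : Fin d, place d i ∘ₗ Matrix.toLin'.toLinearMap

/-- `ρ_d` respects commutators. -/
theorem rho_commutator (d : ℕ) (x y : Matrix (Fin 2) (Fin 2) ℚ) :
    rho d (x * y - y * x) = rho d x * rho d y - rho d y * rho d x := by
  simp only [rho, LinearMap.sum_apply, LinearMap.comp_apply,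
    LinearEquiv.coe_coe, map_sub, Matrix.toLin'_mul, ← Module.End.mul_eq_comp,
    place_mul, Finset.sum_mul_sum]
  rw [Finset.sum_comm (f := fun i j => place d i (Matrix.toLin' y) * _)]
  rw [← Finset.sum_sub_distrib, ← Finset.sum_sub_distrib]
  refine Finset.sum_congr rfl fun i _ => ?_
  rw [← Finset.sum_sub_distrib, Finset.sum_eq_single i]
  · intro j _ hj
    exact sub_eq_zero.mpr (place_commute d hj.symm _ _).eq
  · simp

/-- The matrix units of `𝔤𝔩₂(ℚ)`. -/
def matE : Matrix (Fin 2) (Fin 2) ℚ := !![0, 1; 0, 0]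
def matF : Matrix (Fin 2) (Fin 2) ℚ := !![0, 0; 1, 0]
def matH₁ : Matrix (Fin 2) (Fin 2) ℚ := !![1, 0; 0, 0]
def matH₂ : Matrix (Fin 2) (Fin 2) ℚ := !![0, 0; 0, 1]

/-- The product `T (T - 1) ⋯ (T - d)` in an associative algebra. -/
def fallingProd {A : Type} [Ring A] (d : ℕ) (T : A) : A :=
  ((List.range (d + 1)).map fun k : ℕ => T - (k : A)).prod

/-- Names of the generators of the three-generator presentation. -/
inductive Gen₃ : Type
  | e | f | H₁

/-- The defining relations of the three-generator presentation. -/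
inductive Rel₃ (d : ℕ) : FreeAlgebra ℚ Gen₃ → FreeAlgebra ℚ Gen₃ → Prop
  | H₁_e : Rel₃ d
      (FreeAlgebra.ι ℚ Gen₃.H₁ * FreeAlgebra.ι ℚ Gen₃.e
        - FreeAlgebra.ι ℚ Gen₃.e * FreeAlgebra.ι ℚ Gen₃.H₁)
      (FreeAlgebra.ι ℚ Gen₃.e)
  | e_f : Rel₃ d
      (FreeAlgebra.ι ℚ Gen₃.e * FreeAlgebra.ι ℚ Gen₃.f
        - FreeAlgebra.ι ℚ Gen₃.f * FreeAlgebra.ι ℚ Gen₃.e)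
      (2 * FreeAlgebra.ι ℚ Gen₃.H₁ - (d : FreeAlgebra ℚ Gen₃))
  | H₁_f : Rel₃ d
      (FreeAlgebra.ι ℚ Gen₃.H₁ * FreeAlgebra.ι ℚ Gen₃.f
        - FreeAlgebra.ι ℚ Gen₃.f * FreeAlgebra.ι ℚ Gen₃.H₁)
      (-FreeAlgebra.ι ℚ Gen₃.f)
  | minpoly : Rel₃ d (fallingProd d (FreeAlgebra.ι ℚ Gen₃.H₁)) 0

/-- The associative unital `ℚ`-algebra generated by `e, f, H₁` subject to
`H₁e - eH₁ = e`, `ef - fe = 2H₁ - d`, `H₁f - fH₁ = -f`, `H₁(H₁-1)⋯(H₁-d) = 0`. -/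
abbrev PresA (d : ℕ) : Type := RingQuot (Rel₃ d)

/-- The generators of `PresA d`. -/
def genA (d : ℕ) (x : Gen₃) : PresA d := RingQuot.mkAlgHom ℚ (Rel₃ d) (FreeAlgebra.ι ℚ x)

/-- Names of the generators of the four-generator presentation. -/
inductive Gen₄ : Type
  | e | f | H₁ | H₂

/-- The defining relations of `U(𝔤𝔩₂)`, together with `H₁ + H₂ = d` and
`H₁(H₁-1)⋯(H₁-d) = 0`. -/
inductive Rel₄ (d : ℕ) : FreeAlgebra ℚ Gen₄ → FreeAlgebra ℚ Gen₄ → Prop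
  | H₁_H₂ : Rel₄ d
      (FreeAlgebra.ι ℚ Gen₄.H₁ * FreeAlgebra.ι ℚ Gen₄.H₂)
      (FreeAlgebra.ι ℚ Gen₄.H₂ * FreeAlgebra.ι ℚ Gen₄.H₁)
  | H₁_e : Rel₄ d
      (FreeAlgebra.ι ℚ Gen₄.H₁ * FreeAlgebra.ι ℚ Gen₄.e
        - FreeAlgebra.ι ℚ Gen₄.e * FreeAlgebra.ι ℚ Gen₄.H₁)
      (FreeAlgebra.ι ℚ Gen₄.e)
  | H₁_f : Rel₄ d
      (FreeAlgebra.ι ℚ Gen₄.H₁ * FreeAlgebra.ι ℚ Gen₄.f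
        - FreeAlgebra.ι ℚ Gen₄.f * FreeAlgebra.ι ℚ Gen₄.H₁)
      (-FreeAlgebra.ι ℚ Gen₄.f)
  | H₂_e : Rel₄ d
      (FreeAlgebra.ι ℚ Gen₄.H₂ * FreeAlgebra.ι ℚ Gen₄.e
        - FreeAlgebra.ι ℚ Gen₄.e * FreeAlgebra.ι ℚ Gen₄.H₂)
      (-FreeAlgebra.ι ℚ Gen₄.e)
  | H₂_f : Rel₄ d
      (FreeAlgebra.ι ℚ Gen₄.H₂ * FreeAlgebra.ι ℚ Gen₄.f
        - FreeAlgebra.ι ℚ Gen₄.f * FreeAlgebra.ι ℚ Gen₄.H₂)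
      (FreeAlgebra.ι ℚ Gen₄.f)
  | e_f : Rel₄ d
      (FreeAlgebra.ι ℚ Gen₄.e * FreeAlgebra.ι ℚ Gen₄.f
        - FreeAlgebra.ι ℚ Gen₄.f * FreeAlgebra.ι ℚ Gen₄.e)
      (FreeAlgebra.ι ℚ Gen₄.H₁ - FreeAlgebra.ι ℚ Gen₄.H₂)
  | sum : Rel₄ d
      (FreeAlgebra.ι ℚ Gen₄.H₁ + FreeAlgebra.ι ℚ Gen₄.H₂) (d : FreeAlgebra ℚ Gen₄)
  | minpoly : Rel₄ d (fallingProd d (FreeAlgebra.ι ℚ Gen₄.H₁)) 0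

/-- The algebra `𝓑_d`. -/
abbrev PresB (d : ℕ) : Type := RingQuot (Rel₄ d)

/-- The generators of `PresB d`. -/
def genB (d : ℕ) (x : Gen₄) : PresB d := RingQuot.mkAlgHom ℚ (Rel₄ d) (FreeAlgebra.ι ℚ x)

/-- The exponents `(a, b, c)` of natural numbers with `a + b + c ≤ d`. -/
abbrev TruncIndex (d : ℕ) : Type := {t : ℕ × ℕ × ℕ // t.1 + t.2.1 + t.2.2 ≤ d}

/-- The monomial `x^a y^b z^c`. -/
def mono {A : Type} [Ring A] (x y z : A) (t : ℕ × ℕ × ℕ) : A :=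
  x ^ t.1 * y ^ t.2.1 * z ^ t.2.2

end

end SchurTwo

namespace SchurTwo

noncomputable section

open scoped TensorProduct

/-! ### Filtration by the powers of a commutator-closed subspace -/

section Filtration

variable {A : Type} [Ring A] [Algebra ℚ A] {W : Submodule ℚ A}

/-! The proof squeezes dimensions. Let `N` be the number of triples with `a + b + c ≤ d`, and let
`A` be either presented algebra, acting on tensor space through `ρ_d`. The argument shows `N ≤ dim
S(2,d) ≤ dim (image of A) ≤ dim A ≤ N`. Equality throughout makes the action faithful with image
exactly `S(2,d)`, and makes any spanning family of `N` monomials a basis.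

Upper bound (`IsSchurTriple.span_mono_eq_top`): put `W = span {1, e, H, f}`. The relations make `W`
closed under commutators, so reordering a product only costs lower filtration degree, and ordered
monomials of degree at most `n` span `W ^ n`. The polynomial relation says `H ^ (d + 1) ∈ W ^ d`.
Since `W ^ d` is stable under `ad e` and `ad f`, commuting with `e` and then with `f` turns factors
`H` into `e` and `f`, up to nonzero rational scalars. Hence every ordered monomial of degree `d + 1`
lies in `W ^ d`, so `W ^ (d + 1) = W ^ d` and `W ^ d` is the whole algebra.

Middle inequality (`schurAlgebra_le`): invertible matrices are products of transvections and
diagonal matrices. The former act as exponentials of nilpotent elements `ρ_d(c e_ij)`, the latter as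
polynomials in `ρ_d(e₁₁)`, so the image of `A` contains `S(2,d)`. The reverse inclusion comes out of
the dimension count.

Lower bound (`card_truncIndex_le_finrank`): matrix coefficients of `g ^ {⊗ d}` are the degree `d`
monomials in the entries of `g`. With one entry set to `1` they give `N` independent functions. -/

theorem pow_le_pow_of_one_mem (h1 : 1 ∈ W) {m n : ℕ} (h : m ≤ n) : W ^ m ≤ W ^ n := by
  induction n, h using Nat.le_induction with
  | base => exact le_rfl
  | succ n _ ih =>
    refine ih.trans fun u hu => ?_
    rw [pow_succ']
    simpa using Submodule.mul_mem_mul h1 hu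

theorem mul_mem_pow_of_le (h1 : 1 ∈ W) {m n k : ℕ} {u v : A} (hu : u ∈ W ^ m) (hv : v ∈ W ^ n)
    (h : m + n ≤ k) : u * v ∈ W ^ k := by
  refine pow_le_pow_of_one_mem h1 h ?_
  rw [pow_add]
  exact Submodule.mul_mem_mul hu hv

/-- If `W` is closed under commutators then so is each filtration step `W ^ n` under commutators
with elements of `W`. -/
theorem commutator_mem_pow (hW : ∀ x ∈ W, ∀ y ∈ W, x * y - y * x ∈ W) {x : A} (hx : x ∈ W) (n : ℕ) :
    ∀ u ∈ W ^ n, x * u - u * x ∈ W ^ n := by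
  induction n with
  | zero =>
    intro u hu
    rw [pow_zero, Submodule.mem_one] at hu
    obtain ⟨c, rfl⟩ := hu
    rw [Algebra.commutes, sub_self]
    exact zero_mem _
  | succ n ih =>
    intro u hu
    rw [pow_succ'] at hu ⊢
    induction hu using Submodule.mul_induction_on' with
    | mem_mul_mem y hy v hv =>
      have : x * (y * v) - y * v * x = (x * y - y * x) * v + y * (x * v - v * x) := by noncomm_ring
      rw [this]
      exact add_mem (Submodule.mul_mem_mul (hW x hx y hy) hv) (Submodule.mul_mem_mul hy (ih v hv))
    | add u _ v _ hu hv =>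
      have : x * (u + v) - (u + v) * x = (x * u - u * x) + (x * v - v * x) := by noncomm_ring
      rw [this]
      exact add_mem hu hv

/-- The commutator with a power of `y`, up to lower filtration degree. -/
theorem commutator_pow_succ_sub_mem (hW : ∀ x ∈ W, ∀ y ∈ W, x * y - y * x ∈ W) {x y : A}
    (hx : x ∈ W) (hy : y ∈ W) (b : ℕ) :
    (x * y ^ (b + 1) - y ^ (b + 1) * x) - ((b : ℚ) + 1) • ((x * y - y * x) * y ^ b) ∈ W ^ b := by
  induction b with
  | zero => simp
  | succ b ih =>
    -- Peel one `y` off on the right by the Leibniz rule. Moving `[x, y]` to the left of `y ^ (b +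
    -- 1)` costs a commutator that stays in `W ^ (b + 1)`.
    have key : (x * y ^ (b + 1 + 1) - y ^ (b + 1 + 1) * x)
          - (((b + 1 : ℕ) : ℚ) + 1) • ((x * y - y * x) * y ^ (b + 1))
        = ((x * y ^ (b + 1) - y ^ (b + 1) * x) - ((b : ℚ) + 1) • ((x * y - y * x) * y ^ b)) * y
          - ((x * y - y * x) * y ^ (b + 1) - y ^ (b + 1) * (x * y - y * x)) := by
      have hz : y ^ (b + 1) * (x * y - y * x) = y ^ (b + 1) * x * y - y ^ (b + 1) * y * x := by
        noncomm_ring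
      rw [hz, sub_mul _ _ y, smul_mul_assoc, mul_assoc (x * y - y * x), ← pow_succ,
        pow_succ y (b + 1)]
      generalize x * y - y * x = z
      generalize y ^ (b + 1) = Y
      push_cast
      simp only [add_smul, one_smul, sub_mul, mul_assoc]
      abel
    rw [key]
    refine sub_mem ?_ (commutator_mem_pow hW (hW x hx y hy) _ _ (Submodule.pow_mem_pow _ hy _))
    rw [pow_succ]
    exact Submodule.mul_mem_mul ih hy

end Filtration

/-! ### Upper bound: truncated monomials span -/

/-- The defining relations of the three-generator presentation, for elements of a ring. -/
structure IsSchurTriple {A : Type} [Ring A] (d : ℕ) (e H f : A) : Prop where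
  H_e : H * e - e * H = e
  e_f : e * f - f * e = 2 * H - (d : A)
  H_f : H * f - f * H = -f
  fallingProd_eq_zero : fallingProd d H = 0

/-- The span of `1, e, H, f`. -/
def genSpan {A : Type} [Ring A] [Algebra ℚ A] (e H f : A) : Submodule ℚ A :=
  Submodule.span ℚ {1, e, H, f}

theorem fallingProd_succ {A : Type} [Ring A] (d : ℕ) (T : A) :
    fallingProd (d + 1) T = fallingProd d T * (T - ((d + 1 : ℕ) : A)) := by
  simp [fallingProd, List.range_succ (n := d + 1)]

section Spanning

variable {A : Type} [Ring A] [Algebra ℚ A] {d : ℕ} {e H f : A}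

theorem one_mem_genSpan : 1 ∈ genSpan e H f := Submodule.subset_span (by simp)
theorem e_mem_genSpan : e ∈ genSpan e H f := Submodule.subset_span (by simp)
theorem H_mem_genSpan : H ∈ genSpan e H f := Submodule.subset_span (by simp)
theorem f_mem_genSpan : f ∈ genSpan e H f := Submodule.subset_span (by simp)

/-- By bilinearity only commutators of generators matter. The constant `d` in `[e, f]` is why `1`
has to be in the span. -/
theorem IsSchurTriple.commutator_mem (h : IsSchurTriple d e H f) :
    ∀ x ∈ genSpan e H f, ∀ y ∈ genSpan e H f, x * y - y * x ∈ genSpan e H f := by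
  have he : e ∈ genSpan e H f := e_mem_genSpan
  have hf : f ∈ genSpan e H f := f_mem_genSpan
  have h2 : 2 * H - (d : A) ∈ genSpan e H f := by
    refine sub_mem ?_ ?_
    · rw [two_mul]
      exact add_mem H_mem_genSpan H_mem_genSpan
    · rw [← nsmul_one]
      exact nsmul_mem one_mem_genSpan d
  intro x hx y hy
  induction hx, hy using Submodule.span_induction₂ with
  | mem_mem x y hx hy =>
    rcases hx with rfl | rfl | rfl | rfl <;> rcases hy with rfl | rfl | rfl | rfl <;>
    first
    | simp only [sub_self, mul_one, one_mul]; exact zero_mem _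
    | rw [h.H_e]; exact he
    | rw [h.e_f]; exact h2
    | rw [h.H_f]; exact neg_mem hf
    | rw [← neg_sub, h.H_e]; exact neg_mem he
    | rw [← neg_sub, h.e_f]; exact neg_mem h2
    | rw [← neg_sub, h.H_f]; exact neg_mem (neg_mem hf)
  | zero_left y _ => simp
  | zero_right x _ => simp
  | add_left x y z _ _ _ h1 h2 =>
    have : (x + y) * z - z * (x + y) = (x * z - z * x) + (y * z - z * y) := by noncomm_ring
    rw [this]; exact add_mem h1 h2
  | add_right x y z _ _ _ h1 h2 =>
    have : x * (y + z) - (y + z) * x = (x * y - y * x) + (x * z - z * x) := by noncomm_ring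
    rw [this]; exact add_mem h1 h2
  | smul_left r x y _ _ h =>
    rw [smul_mul_assoc, mul_smul_comm, ← smul_sub]; exact Submodule.smul_mem _ _ h
  | smul_right r x y _ _ h =>
    rw [smul_mul_assoc, mul_smul_comm, ← smul_sub]; exact Submodule.smul_mem _ _ h

theorem mul_mul_mem_genSpan_pow {a b c n : ℕ} (hn : a + b + c ≤ n) :
    e ^ a * H ^ b * f ^ c ∈ genSpan e H f ^ n :=
  mul_mem_pow_of_le one_mem_genSpan (mul_mem_pow_of_le one_mem_genSpan
    (Submodule.pow_mem_pow _ e_mem_genSpan _) (Submodule.pow_mem_pow _ H_mem_genSpan _) le_rfl)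
    (Submodule.pow_mem_pow _ f_mem_genSpan _) hn

/-- Ordered monomials of degree at most `n` span the `n`-th filtration step. -/
theorem IsSchurTriple.genSpan_pow_le (h : IsSchurTriple d e H f) (n : ℕ) :
    genSpan e H f ^ n ≤ Submodule.span ℚ (mono e H f '' {t | t.1 + t.2.1 + t.2.2 ≤ n}) := by
  have hW := h.commutator_mem
  have mem : ∀ {n a b c : ℕ}, a + b + c ≤ n →
      e ^ a * H ^ b * f ^ c ∈ Submodule.span ℚ (mono e H f '' {t | t.1 + t.2.1 + t.2.2 ≤ n}) :=
    fun {n a b c} hn => Submodule.subset_span ⟨(a, b, c), hn, rfl⟩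
  induction n with
  | zero =>
    rw [pow_zero, Submodule.one_le]
    simpa using mem (n := 0) (a := 0) (b := 0) (c := 0) le_rfl
  | succ n ih =>
    have mono_le : Submodule.span ℚ (mono e H f '' {t | t.1 + t.2.1 + t.2.2 ≤ n})
        ≤ Submodule.span ℚ (mono e H f '' {t | t.1 + t.2.1 + t.2.2 ≤ n + 1}) :=
      Submodule.span_mono (Set.image_mono fun t (ht : _ ≤ n) => ht.trans n.le_succ)
    have lower := ih.trans mono_le
    rw [pow_succ']
    refine (mul_le_mul_right ih _).trans ?_
    rw [genSpan, Submodule.span_mul_span, Submodule.span_le]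
    rintro _ ⟨x, hx, _, ⟨⟨a, b, c⟩, ht, rfl⟩, rfl⟩
    simp only [Set.mem_ofPred_eq] at ht
    simp only [mono, SetLike.mem_coe]
    rcases hx with rfl | rfl | rfl | rfl
    · rw [one_mul]
      exact mem (ht.trans n.le_succ)
    · rw [← mul_assoc, ← mul_assoc, ← pow_succ']
      exact mem (by omega)
    -- Here `x` is `H`; passing it through `e ^ a` leaves an error of degree at most `a + b + c ≤
    -- n`, covered by induction.
    · have key : x * (e ^ a * x ^ b * f ^ c)
          = e ^ a * x ^ (b + 1) * f ^ c + (x * e ^ a - e ^ a * x) * x ^ b * f ^ c := by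
        rw [pow_succ']; noncomm_ring
      rw [key]
      refine add_mem (mem (by omega)) (lower ?_)
      exact mul_mem_pow_of_le one_mem_genSpan (mul_mem_pow_of_le one_mem_genSpan
        (commutator_mem_pow hW H_mem_genSpan _ _ (Submodule.pow_mem_pow _ e_mem_genSpan _))
        (Submodule.pow_mem_pow _ H_mem_genSpan _) le_rfl)
        (Submodule.pow_mem_pow _ f_mem_genSpan _) ht
    · have key : x * (e ^ a * H ^ b * x ^ c)
          = e ^ a * H ^ b * x ^ (c + 1)
            + (x * (e ^ a * H ^ b) - e ^ a * H ^ b * x) * x ^ c := by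
        rw [pow_succ']; noncomm_ring
      rw [key]
      refine add_mem (mem (by omega)) (lower ?_)
      refine mul_mem_pow_of_le one_mem_genSpan (commutator_mem_pow hW f_mem_genSpan (a + b) _ ?_)
        (Submodule.pow_mem_pow _ f_mem_genSpan _) ht
      simpa using mul_mul_mem_genSpan_pow (e := e) (H := H) (f := x) (c := 0) le_rfl

/-- The falling product is monic of degree `n + 1`. When it vanishes, this places `H ^ (n + 1)` in
`W ^ n`. -/
theorem fallingProd_sub_pow_mem (e H f : A) (n : ℕ) :
    fallingProd n H - H ^ (n + 1) ∈ genSpan e H f ^ n := by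
  induction n with
  | zero => simp [fallingProd]
  | succ n ih =>
    have hH : H ∈ genSpan e H f := H_mem_genSpan
    have key : fallingProd (n + 1) H - H ^ (n + 1 + 1)
        = (fallingProd n H - H ^ (n + 1)) * (H - ((n + 1 : ℕ) : A))
          - (n + 1) • H ^ (n + 1) := by
      rw [fallingProd_succ, pow_succ H (n + 1), nsmul_eq_mul,
        (Nat.cast_commute (n + 1) (H ^ (n + 1))).eq]
      noncomm_ring
    rw [key]
    refine sub_mem ?_ (nsmul_mem (Submodule.pow_mem_pow _ hH _) _)
    rw [pow_succ]
    refine Submodule.mul_mem_mul ih (sub_mem hH ?_)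
    rw [← nsmul_one]
    exact nsmul_mem one_mem_genSpan _

/-- Start from `H ^ (d + 1)` and apply `ad e` repeatedly: since `[e, H] = -e`, the commutator of `e`
with `e ^ a * H ^ (b + 1)` is `-(b + 1) e ^ (a + 1) H ^ b` modulo `W ^ (a + b)`, and `b + 1` is
invertible in `ℚ`. -/
theorem IsSchurTriple.pow_mul_pow_mem (h : IsSchurTriple d e H f) (a b : ℕ) (hab : a + b = d + 1) :
    e ^ a * H ^ b ∈ genSpan e H f ^ d := by
  induction a generalizing b with
  | zero =>
    obtain rfl : b = d + 1 := by omega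
    have := fallingProd_sub_pow_mem e H f d
    rw [h.fallingProd_eq_zero, zero_sub, neg_mem_iff] at this
    simpa using this
  | succ a ih =>
    have hW := h.commutator_mem
    have h1 := commutator_mem_pow hW e_mem_genSpan d _ (ih (b + 1) (by omega))
    have h2 := mul_mem_pow_of_le one_mem_genSpan (Submodule.pow_mem_pow _ e_mem_genSpan a)
      (commutator_pow_succ_sub_mem hW e_mem_genSpan H_mem_genSpan b) (show a + b ≤ d by omega)
    have he : e * H - H * e = -e := by rw [← neg_sub, h.H_e]
    have key : ((b : ℚ) + 1) • (e ^ (a + 1) * H ^ b)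
        = e ^ a * ((e * H ^ (b + 1) - H ^ (b + 1) * e) - ((b : ℚ) + 1) • ((e * H - H * e) * H ^ b))
          - (e * (e ^ a * H ^ (b + 1)) - e ^ a * H ^ (b + 1) * e) := by
      rw [he, neg_mul, smul_neg, sub_neg_eq_add, mul_add, mul_smul_comm, ← mul_assoc (e ^ a) e,
        ← pow_succ, mul_sub, ← mul_assoc (e ^ a) e, ← mul_assoc e (e ^ a), ← pow_succ, ← pow_succ']
      noncomm_ring
    have := sub_mem h2 h1
    rw [← key] at this
    exact (Submodule.smul_mem_iff _ (by positivity)).mp this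

/-- Apply `ad f` to `e ^ a * H ^ (b + 1) * f ^ c`. Modulo `W ^ d`, the part from `[f, H ^ (b + 1)]`
is `b + 1` times the wanted monomial. The part from `[f, e ^ a]` keeps the exponent `c`, so
induction on `c` with `a` and `b` free disposes of it. -/
theorem IsSchurTriple.pow_mul_pow_mul_pow_mem (h : IsSchurTriple d e H f) (a b c : ℕ)
    (habc : a + b + c = d + 1) : e ^ a * H ^ b * f ^ c ∈ genSpan e H f ^ d := by
  induction c generalizing a b with
  | zero => simpa using h.pow_mul_pow_mem a b (by omega)
  | succ c ih =>
    have hW := h.commutator_mem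
    have hfc : f ^ c ∈ genSpan e H f ^ c := Submodule.pow_mem_pow _ f_mem_genSpan _
    have hea : e ^ a ∈ genSpan e H f ^ a := Submodule.pow_mem_pow _ e_mem_genSpan _
    have h1 := commutator_mem_pow hW f_mem_genSpan d _ (ih a (b + 1) (by omega))
    have hHb : H ^ (b + 1) ∈ genSpan e H f ^ (b + 1) := Submodule.pow_mem_pow _ H_mem_genSpan _
    -- As `[f, e] = d - 2H`, removing one `e` gains one `H`: the top term is a multiple of the
    -- monomial with exponents `a - 1, b + 2, c`, again of degree `d + 1`.
    have fst : (f * e ^ a - e ^ a * f) * H ^ (b + 1) * f ^ c ∈ genSpan e H f ^ d := by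
      cases a with
      | zero => simp
      | succ a =>
        have h3 := mul_mem_pow_of_le one_mem_genSpan (mul_mem_pow_of_le one_mem_genSpan
          (commutator_pow_succ_sub_mem hW f_mem_genSpan e_mem_genSpan a) hHb le_rfl) hfc
          (show a + (b + 1) + c ≤ d by omega)
        have hfe : f * e - e * f = (d : A) - 2 * H := by rw [← neg_sub, h.e_f, neg_sub]
        have hHe := mul_mem_pow_of_le one_mem_genSpan (mul_mem_pow_of_le one_mem_genSpan
          (commutator_mem_pow hW H_mem_genSpan a _ (Submodule.pow_mem_pow _ e_mem_genSpan a)) hHb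
            le_rfl) hfc (show a + (b + 1) + c ≤ d by omega)
        have h4 := ih a (b + 1 + 1) (by omega)
        have h5 : e ^ a * H ^ (b + 1) * f ^ c ∈ genSpan e H f ^ d :=
          mul_mul_mem_genSpan_pow (by omega)
        have key : (f * e - e * f) * e ^ a * H ^ (b + 1) * f ^ c
            = d • (e ^ a * H ^ (b + 1) * f ^ c)
              - 2 • (e ^ a * H ^ (b + 1 + 1) * f ^ c
                + (H * e ^ a - e ^ a * H) * H ^ (b + 1) * f ^ c) := by
          rw [hfe, pow_succ' H (b + 1), nsmul_eq_mul]
          noncomm_ring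
        have h6 : (f * e - e * f) * e ^ a * H ^ (b + 1) * f ^ c ∈ genSpan e H f ^ d := by
          rw [key]
          exact sub_mem (nsmul_mem h5 _) (nsmul_mem (add_mem h4 hHe) _)
        have := add_mem h3 (Submodule.smul_mem _ ((a : ℚ) + 1) h6)
        simpa only [sub_mul, smul_mul_assoc, sub_add_cancel] using this
    have h2 := mul_mem_pow_of_le one_mem_genSpan (mul_mem_pow_of_le one_mem_genSpan hea
      (commutator_pow_succ_sub_mem hW f_mem_genSpan H_mem_genSpan b) le_rfl) hfc
      (show a + b + c ≤ d by omega)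
    have hfH : f * H - H * f = f := by rw [← neg_sub, h.H_f, neg_neg]
    have h7 := mul_mem_pow_of_le one_mem_genSpan (mul_mem_pow_of_le one_mem_genSpan hea
      (commutator_mem_pow hW f_mem_genSpan b _ (Submodule.pow_mem_pow _ H_mem_genSpan b)) le_rfl)
      hfc (show a + b + c ≤ d by omega)
    have key : ((b : ℚ) + 1) • (e ^ a * H ^ b * f ^ (c + 1))
        = (f * (e ^ a * H ^ (b + 1) * f ^ c) - e ^ a * H ^ (b + 1) * f ^ c * f)
          - (f * e ^ a - e ^ a * f) * H ^ (b + 1) * f ^ c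
          - e ^ a * ((f * H ^ (b + 1) - H ^ (b + 1) * f)
              - ((b : ℚ) + 1) • ((f * H - H * f) * H ^ b)) * f ^ c
          - ((b : ℚ) + 1) • (e ^ a * (f * H ^ b - H ^ b * f) * f ^ c) := by
      have hcomm : f ^ c * f = f * f ^ c := by rw [← pow_succ, pow_succ']
      rw [hfH, pow_succ' f c]
      simp only [mul_sub, sub_mul, smul_sub, mul_smul_comm, smul_mul_assoc, mul_assoc, hcomm]
      abel
    have := sub_mem (sub_mem (sub_mem h1 fst) h2) (Submodule.smul_mem _ ((b : ℚ) + 1) h7)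
    rw [← key] at this
    exact (Submodule.smul_mem_iff _ (by positivity)).mp this

/-- If `e, H, f` generate the algebra, then the truncated monomials span it. -/
theorem IsSchurTriple.span_mono_eq_top (h : IsSchurTriple d e H f)
    (hgen : Algebra.adjoin ℚ {e, H, f} = ⊤) :
    Submodule.span ℚ (Set.range fun t : TruncIndex d => mono e H f t) = ⊤ := by
  have hsucc : genSpan e H f ^ (d + 1) ≤ genSpan e H f ^ d := by
    refine (h.genSpan_pow_le (d + 1)).trans (Submodule.span_le.mpr ?_)
    rintro _ ⟨⟨a, b, c⟩, ht, rfl⟩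
    rcases Nat.lt_or_ge d (a + b + c) with hd | hd
    · exact h.pow_mul_pow_mul_pow_mem a b c (le_antisymm ht hd)
    · exact mul_mul_mem_genSpan_pow hd
  -- `W ^ d` contains `1` and, by `hsucc`, is stable under left multiplication by the generators.
  have htop : genSpan e H f ^ d = ⊤ := by
    refine eq_top_iff.mpr fun u hu' => ?_
    clear hu'
    have hu : u ∈ Algebra.adjoin ℚ {e, H, f} := hgen ▸ Algebra.mem_top
    suffices ∀ v ∈ genSpan e H f ^ d, u * v ∈ genSpan e H f ^ d by
      simpa using this 1 (by
        simpa using mul_mul_mem_genSpan_pow (e := e) (H := H) (f := f) (a := 0) (b := 0) (c := 0)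
          (Nat.zero_le d))
    induction hu using Algebra.adjoin_induction with
    | mem x hx =>
      intro v hv
      refine hsucc ?_
      rw [pow_succ']
      exact Submodule.mul_mem_mul (Submodule.subset_span (Or.inr hx)) hv
    | algebraMap r =>
      intro v hv
      rw [← Algebra.smul_def]
      exact Submodule.smul_mem _ _ hv
    | add x y _ _ hx hy =>
      intro v hv
      rw [add_mul]
      exact add_mem (hx v hv) (hy v hv)
    | mul x y _ _ hx hy =>
      intro v hv
      rw [mul_assoc]
      exact hx _ (hy v hv)
  refine eq_top_iff.mpr (htop ▸ (h.genSpan_pow_le d).trans (Submodule.span_mono ?_))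
  rintro _ ⟨t, ht, rfl⟩
  exact ⟨⟨t, ht⟩, rfl⟩

end Spanning

/-! ### The action of `𝔤𝔩₂` on tensor space generates the operators of `GL₂` -/

theorem place_one (d : ℕ) (i : Fin d) : place d i 1 = 1 := by
  rw [place_apply, Pi.mulSingle_one, map_one]

theorem rho_apply (d : ℕ) (x : Matrix (Fin 2) (Fin 2) ℚ) :
    rho d x = ∑ i : Fin d, place d i (Matrix.toLin' x) := by
  simp [rho]

theorem rho_one (d : ℕ) : rho d 1 = (d : Module.End ℚ (TensorSpace d)) := by
  rw [rho_apply, Matrix.toLin'_one]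
  simp only [← Module.End.one_eq_id, place_one]
  simp

/-- The tensor power `A ⊗ ⋯ ⊗ A` of a matrix. -/
def tensorPow (d : ℕ) (M : Matrix (Fin 2) (Fin 2) ℚ) : Module.End ℚ (TensorSpace d) :=
  PiTensorProduct.map fun _ : Fin d => Matrix.toLin' M

theorem tensorPow_mul (d : ℕ) (M N : Matrix (Fin 2) (Fin 2) ℚ) :
    tensorPow d (M * N) = tensorPow d M * tensorPow d N := by
  simp only [tensorPow, Matrix.toLin'_mul]
  exact PiTensorProduct.map_comp _ _

theorem isNilpotent_sum_place (d : ℕ) {n : Module.End ℚ E} (hn : n * n = 0) (s : Finset (Fin d)) :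
    IsNilpotent (∑ i ∈ s, place d i n) := by
  refine Commute.isNilpotent_sum (fun i _ => ⟨2, ?_⟩) fun i j _ _ => ?_
  · rw [pow_two, ← place_mul, hn, map_zero]
  · rcases eq_or_ne i j with rfl | h
    · exact Commute.refl _
    · exact place_commute d h _ _

/-- In one position, `n * n = 0` gives `exp n = 1 + n`; different positions commute, so the
exponentials multiply. The subset `s` is there for the induction, and the full set is the case
needed. -/
theorem mapMonoidHom_ite_eq_exp (d : ℕ) {n : Module.End ℚ E} (hn : n * n = 0)
    (s : Finset (Fin d)) :
    PiTensorProduct.mapMonoidHom (fun i : Fin d => if i ∈ s then 1 + n else 1)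
      = IsNilpotent.exp (∑ i ∈ s, place d i n) := by
  induction s using Finset.induction_on with
  | empty =>
    simp only [Finset.notMem_empty, if_false, Finset.sum_empty, IsNilpotent.exp_zero]
    exact map_one _
  | insert a s ha ih =>
    have hsq : place d a n ^ 2 = 0 := by rw [pow_two, ← place_mul, hn, map_zero]
    have hexp : IsNilpotent.exp (place d a n) = place d a (1 + n) := by
      rw [IsNilpotent.exp_eq_sum hsq]
      simp [Finset.sum_range_succ, place_one]
    have hcomm : Commute (place d a n) (∑ i ∈ s, place d i n) :=
      Commute.sum_right _ _ _ fun i hi =>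
        place_commute d (by rintro rfl; exact ha hi) _ _
    rw [Finset.sum_insert ha, IsNilpotent.exp_add_of_commute hcomm ⟨2, hsq⟩
      (isNilpotent_sum_place d hn s), ← ih, hexp, place_apply, ← map_mul]
    congr 1
    funext i
    rcases eq_or_ne i a with rfl | h
    · simp [ha]
    · simp [h]

/-- A unipotent matrix acts on tensor space as the exponential of its nilpotent part. -/
theorem tensorPow_one_add (d : ℕ) {N : Matrix (Fin 2) (Fin 2) ℚ} (hN : N * N = 0) :
    tensorPow d (1 + N) = IsNilpotent.exp (rho d N) := by
  have hn : Matrix.toLin' N * Matrix.toLin' N = 0 := by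
    rw [Module.End.mul_eq_comp, ← Matrix.toLin'_mul, hN, map_zero]
  have := mapMonoidHom_ite_eq_exp d hn Finset.univ
  simp only [Finset.mem_univ, if_true] at this
  rw [rho_apply, ← this, tensorPow, map_add, Matrix.toLin'_one]
  rfl

theorem exp_mem {A : Type} [Ring A] [Algebra ℚ A] (T : Subalgebra ℚ A) {a : A} (ha : a ∈ T) :
    IsNilpotent.exp a ∈ T :=
  T.sum_mem fun _ _ => T.smul_mem (T.pow_mem ha _) _

/-- The basis of tensor space given by words in the standard basis of `E`. -/
def tensorBasis (d : ℕ) : Module.Basis (Fin d → Fin 2) ℚ (TensorSpace d) :=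
  Basis.piTensorProduct fun _ => Pi.basisFun ℚ (Fin 2)

theorem tensorBasis_apply (d : ℕ) (w : Fin d → Fin 2) :
    tensorBasis d w = PiTensorProduct.tprod ℚ fun i => (Pi.single (w i) 1 : E) := by
  simp [tensorBasis]

theorem tensorPow_tensorBasis (d : ℕ) (M : Matrix (Fin 2) (Fin 2) ℚ) (w : Fin d → Fin 2) :
    tensorPow d M (tensorBasis d w)
      = PiTensorProduct.tprod ℚ fun i => Matrix.toLin' M (Pi.single (w i) 1) := by
  rw [tensorBasis_apply, tensorPow]
  exact PiTensorProduct.map_tprod _ _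

theorem toLin'_diagonal_single (D : Fin 2 → ℚ) (j : Fin 2) :
    Matrix.toLin' (Matrix.diagonal D) (Pi.single j 1) = D j • (Pi.single j 1 : E) := by
  rw [Matrix.toLin'_apply]
  ext i
  rw [Matrix.mulVec_diagonal]
  rcases eq_or_ne i j with rfl | h
  · simp
  · simp [h]

theorem tensorPow_diagonal_tensorBasis (d : ℕ) (D : Fin 2 → ℚ) (w : Fin d → Fin 2) :
    tensorPow d (Matrix.diagonal D) (tensorBasis d w) = (∏ i, D (w i)) • tensorBasis d w := by
  rw [tensorPow_tensorBasis, tensorBasis_apply]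
  simp only [toLin'_diagonal_single]
  exact MultilinearMap.map_smul_univ _ _ _

theorem place_diagonal_tensorBasis (d : ℕ) (i : Fin d) (D : Fin 2 → ℚ) (w : Fin d → Fin 2) :
    place d i (Matrix.toLin' (Matrix.diagonal D)) (tensorBasis d w)
      = D (w i) • tensorBasis d w := by
  have h : ∀ j, (Pi.mulSingle i (Matrix.toLin' (Matrix.diagonal D)) : Fin d → Module.End ℚ E) j
      (Pi.single (w j) 1)
      = (Pi.mulSingle i (D (w i)) : Fin d → ℚ) j • (Pi.single (w j) 1 : E) := by
    intro j
    rcases eq_or_ne j i with rfl | hj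
    · simp only [Pi.mulSingle_eq_same, toLin'_diagonal_single]
    · simp only [Pi.mulSingle_eq_of_ne hj, one_smul, Module.End.one_apply]
  rw [place_apply, tensorBasis_apply, PiTensorProduct.mapMonoidHom_apply,
    PiTensorProduct.map_tprod]
  simp only [h]
  rw [MultilinearMap.map_smul_univ, Finset.prod_pi_mulSingle']
  simp

/-- The number of letters `0` in a word. -/
def zeroCount {d : ℕ} (w : Fin d → Fin 2) : ℕ := (Finset.univ.filter fun i => w i = 0).card

theorem zeroCount_le {d : ℕ} (w : Fin d → Fin 2) : zeroCount w ≤ d := by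
  simpa [zeroCount] using Finset.card_filter_le (Finset.univ : Finset (Fin d)) fun i => w i = 0

theorem rho_matH₁_tensorBasis (d : ℕ) (w : Fin d → Fin 2) :
    rho d matH₁ (tensorBasis d w) = (zeroCount w : ℚ) • tensorBasis d w := by
  have hH : matH₁ = Matrix.diagonal ![1, 0] := by
    ext i j; fin_cases i <;> fin_cases j <;> simp [matH₁]
  rw [rho_apply, LinearMap.sum_apply, hH]
  simp only [place_diagonal_tensorBasis]
  rw [← Finset.sum_smul, zeroCount, Finset.card_filter]
  push_cast
  congr 1
  refine Finset.sum_congr rfl fun i _ => ?_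
  generalize w i = j
  fin_cases j <;> simp

theorem prod_word {d : ℕ} (D : Fin 2 → ℚ) (w : Fin d → Fin 2) :
    ∏ i, D (w i) = D 0 ^ zeroCount w * D 1 ^ (d - zeroCount w) := by
  have h : (Finset.univ.filter fun i => ¬ w i = 0).card = d - zeroCount w := by
    have := Finset.card_filter_add_card_filter_not (s := (Finset.univ : Finset (Fin d)))
      (fun i => w i = 0)
    simp only [Finset.card_univ, Fintype.card_fin] at this
    rw [zeroCount]
    omega
  have h' : ∀ i, D (w i) = if w i = 0 then D 0 else D 1 := by
    intro i
    generalize w i = j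
    fin_cases j <;> simp
  simp only [h', Finset.prod_ite, Finset.prod_const, h]
  rfl

theorem map_fallingProd {A B : Type} [Ring A] [Ring B] (φ : A →+* B) (d : ℕ) (T : A) :
    φ (fallingProd d T) = fallingProd d (φ T) := by
  induction d with
  | zero => simp [fallingProd]
  | succ d ih => rw [fallingProd_succ, fallingProd_succ, map_mul, ih, map_sub, map_natCast]

theorem fallingProd_natCast {A : Type} [Ring A] {d k : ℕ} (h : k ≤ d) :
    fallingProd d (k : A) = 0 := by
  induction d with
  | zero => simp [fallingProd, Nat.le_zero.mp h]
  | succ d ih =>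
    rw [fallingProd_succ]
    rcases h.eq_or_lt with rfl | h
    · rw [sub_self, mul_zero]
    · rw [ih (Nat.lt_succ_iff.mp h), zero_mul]

theorem eval_fallingProd (d : ℕ) (q : ℚ) :
    Polynomial.eval q (fallingProd d (Polynomial.X : Polynomial ℚ)) = fallingProd d q := by
  have := map_fallingProd (Polynomial.evalRingHom q) d Polynomial.X
  rwa [Polynomial.coe_evalRingHom, Polynomial.eval_X] at this

theorem aeval_fallingProd {A : Type} [Ring A] [Algebra ℚ A] (d : ℕ) (T : A) :
    Polynomial.aeval T (fallingProd d (Polynomial.X : Polynomial ℚ)) = fallingProd d T := by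
  have := map_fallingProd (Polynomial.aeval T : Polynomial ℚ →ₐ[ℚ] A).toRingHom d Polynomial.X
  simpa using this

/-- Words are eigenvectors whose eigenvalues, the letter counts, lie in `{0, …, d}`. -/
theorem fallingProd_rho_matH₁ (d : ℕ) : fallingProd d (rho d matH₁) = 0 := by
  refine (tensorBasis d).ext fun w => ?_
  rw [← aeval_fallingProd, Module.End.aeval_apply_of_mem_apply_eq_smul
    (rho_matH₁_tensorBasis d w), eval_fallingProd, fallingProd_natCast (zeroCount_le w), zero_smul,
    LinearMap.zero_apply]

theorem rho_matH₁_add_rho_matH₂ (d : ℕ) :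
    rho d matH₁ + rho d matH₂ = (d : Module.End ℚ (TensorSpace d)) := by
  rw [← map_add, ← rho_one]
  congr 1
  ext i j; fin_cases i <;> fin_cases j <;> simp [matH₁, matH₂]

/-- Commutation relations in `𝔤𝔩₂` pass to tensor space. -/
theorem rho_commutator_eq (d : ℕ) {x y z : Matrix (Fin 2) (Fin 2) ℚ} (h : x * y - y * x = z) :
    rho d x * rho d y - rho d y * rho d x = rho d z := by
  rw [← h, rho_commutator]

theorem isSchurTriple_rho (d : ℕ) :
    IsSchurTriple d (rho d matE) (rho d matH₁) (rho d matF) where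
  H_e := rho_commutator_eq d (by
    ext i j; fin_cases i <;> fin_cases j <;> simp [matH₁, matE])
  e_f := by
    rw [← rho_matH₁_add_rho_matH₂, two_mul, add_sub_add_left_eq_sub, ← map_sub]
    exact rho_commutator_eq d (by
      ext i j; fin_cases i <;> fin_cases j <;>
        simp [matH₁, matH₂, matE, matF])
  H_f := by
    rw [← map_neg]
    exact rho_commutator_eq d (by
      ext i j; fin_cases i <;> fin_cases j <;> simp [matH₁, matF])
  fallingProd_eq_zero := fallingProd_rho_matH₁ d

/-- On a word with `k` zeros both operators are scalar, namely `D 0 ^ k * D 1 ^ (d - k)` and `k`.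
Interpolating at the nodes `0, …, d` writes the first operator as a polynomial in the second. -/
theorem tensorPow_diagonal_mem (d : ℕ) (T : Subalgebra ℚ (Module.End ℚ (TensorSpace d)))
    (hH : rho d matH₁ ∈ T) (D : Fin 2 → ℚ) : tensorPow d (Matrix.diagonal D) ∈ T := by
  set p : Polynomial ℚ := Lagrange.interpolate (Finset.range (d + 1)) (fun k : ℕ => (k : ℚ))
    fun k => D 0 ^ k * D 1 ^ (d - k) with hp
  have : tensorPow d (Matrix.diagonal D) = Polynomial.aeval (rho d matH₁) p := by
    refine (tensorBasis d).ext fun w => ?_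
    rw [tensorPow_diagonal_tensorBasis, prod_word,
      Module.End.aeval_apply_of_mem_apply_eq_smul (rho_matH₁_tensorBasis d w), hp,
      Lagrange.eval_interpolate_at_node (v := fun k : ℕ => (k : ℚ)) _
        (Nat.cast_injective.injOn)
        (Finset.mem_range.mpr (Nat.lt_succ_of_le (zeroCount_le w)))]
  rw [this]
  exact Algebra.adjoin_le (Set.singleton_subset_iff.mpr hH)
    (Polynomial.aeval_mem_adjoin_singleton ℚ _)

theorem tensorPow_transvection_mem (d : ℕ) (T : Subalgebra ℚ (Module.End ℚ (TensorSpace d)))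
    (hE : rho d matE ∈ T) (hF : rho d matF ∈ T) (t : Matrix.TransvectionStruct (Fin 2) ℚ) :
    tensorPow d t.toMatrix ∈ T := by
  obtain ⟨i, j, hij, c⟩ := t
  rw [Matrix.TransvectionStruct.toMatrix_mk, Matrix.transvection, tensorPow_one_add d
    (by simp [hij.symm])]
  refine exp_mem T ?_
  have hx : Matrix.single i j c = c • matE ∨ Matrix.single i j c = c • matF := by
    fin_cases i <;> fin_cases j
    · simp at hij
    · left; ext i j; fin_cases i <;> fin_cases j <;> simp [matE, Matrix.single]
    · right; ext i j; fin_cases i <;> fin_cases j <;> simp [matF, Matrix.single]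
    · simp at hij
  rcases hx with hx | hx <;> rw [hx, map_smul]
  · exact T.smul_mem hE c
  · exact T.smul_mem hF c

/-- A subalgebra containing the image of `𝔤𝔩₂` contains the Schur algebra. -/
theorem schurAlgebra_le (d : ℕ) (T : Subalgebra ℚ (Module.End ℚ (TensorSpace d)))
    (hE : rho d matE ∈ T) (hF : rho d matF ∈ T) (hH : rho d matH₁ ∈ T) :
    schurAlgebra d ≤ T := by
  -- Gaussian elimination reduces an invertible matrix to transvections and a diagonal matrix, and
  -- tensor powers are multiplicative.
  have hσ : ∀ M : Matrix (Fin 2) (Fin 2) ℚ, M.det ≠ 0 → tensorPow d M ∈ T := fun M hM =>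
    Matrix.diagonal_transvection_induction_of_det_ne_zero (fun M => tensorPow d M ∈ T) M hM
      (fun D _ => tensorPow_diagonal_mem d T hH D) (tensorPow_transvection_mem d T hE hF)
      fun A B _ _ hA hB => by
        rw [tensorPow_mul]
        exact T.mul_mem hA hB
  rintro _ ⟨u, rfl⟩
  induction u using MonoidAlgebra.induction_linear with
  | zero => rw [map_zero]; exact T.zero_mem
  | add u v hu hv => rw [map_add]; exact T.add_mem hu hv
  | single g r =>
    have : (sigma d).asAlgebraHom (MonoidAlgebra.single g r) = r • tensorPow d g :=
      Representation.asAlgebraHom_single _ _ _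
    exact this ▸ T.smul_mem (hσ g (Matrix.GeneralLinearGroup.det_ne_zero g)) r

/-! ### Lower bound: independent matrix coefficients -/

instance instFiniteTruncIndex (d : ℕ) : Finite (TruncIndex d) := by
  refine Finite.of_injective (β := Fin (d + 1) × Fin (d + 1) × Fin (d + 1))
    (fun t => (⟨t.1.1, by have := t.2; omega⟩, ⟨t.1.2.1, by have := t.2; omega⟩,
      ⟨t.1.2.2, by have := t.2; omega⟩)) ?_
  rintro ⟨⟨a, b, c⟩, _⟩ ⟨⟨a', b', c'⟩, _⟩ h
  simp only [Prod.mk.injEq, Fin.mk.injEq] at h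
  obtain ⟨rfl, rfl, rfl⟩ := h
  rfl

instance instFintypeTruncIndex (d : ℕ) : Fintype (TruncIndex d) := Fintype.ofFinite _

instance instFiniteTensorSpace (d : ℕ) : Module.Finite ℚ (TensorSpace d) :=
  Module.Finite.of_basis (tensorBasis d)

/-- The matrix coefficient of an endomorphism of tensor space at a pair of words. -/
def matrixCoeff (d : ℕ) (p q : Fin d → Fin 2) : Module.End ℚ (TensorSpace d) →ₗ[ℚ] ℚ :=
  (tensorBasis d).coord p ∘ₗ LinearMap.applyₗ (tensorBasis d q)

theorem matrixCoeff_tensorPow (d : ℕ) (p q : Fin d → Fin 2) (M : Matrix (Fin 2) (Fin 2) ℚ) :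
    matrixCoeff d p q (tensorPow d M) = ∏ i, M (p i) (q i) := by
  rw [matrixCoeff, LinearMap.comp_apply, LinearMap.applyₗ_apply_apply, tensorPow_tensorBasis,
    Module.Basis.coord_apply, tensorBasis, Basis.piTensorProduct_repr_tprod_apply]
  simp

/-- The position of the `m`-th entry in a product with `t.1` entries at `(0, 0)`, followed by
`t.2.1` entries at `(0, 1)`, then `t.2.2` entries at `(1, 0)`, then entries at `(1, 1)`. -/
def entryPos (t : ℕ × ℕ × ℕ) (m : ℕ) : Fin 2 × Fin 2 :=
  if m < t.1 then (0, 0) else if m < t.1 + t.2.1 then (0, 1)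
  else if m < t.1 + t.2.1 + t.2.2 then (1, 0) else (1, 1)

/-- Normalising the last entry to `1` makes the remaining `d - (a + b + c)` factors invisible, so
all monomials of degree at most `d` in three variables occur as matrix coefficients. -/
theorem prod_entryPos {d : ℕ} (t : TruncIndex d) (M : Matrix (Fin 2) (Fin 2) ℚ) (h : M 1 1 = 1) :
    ∏ i : Fin d, M (entryPos t i).1 (entryPos t i).2
      = M 0 0 ^ t.1.1 * M 0 1 ^ t.1.2.1 * M 1 0 ^ t.1.2.2 := by
  obtain ⟨⟨a, b, c⟩, ht⟩ := t
  simp only at ht ⊢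
  obtain ⟨l, rfl⟩ := Nat.exists_eq_add_of_le ht
  rw [Fin.prod_univ_eq_prod_range (fun i => M (entryPos (a, b, c) i).1 (entryPos (a, b, c) i).2),
    Finset.prod_range_add, Finset.prod_range_add, Finset.prod_range_add]
  have h1 : ∀ i ∈ Finset.range a, M (entryPos (a, b, c) i).1 (entryPos (a, b, c) i).2 = M 0 0 := by
    intro i hi
    simp [entryPos, Finset.mem_range.mp hi]
  have h2 : ∀ i ∈ Finset.range b,
      M (entryPos (a, b, c) (a + i)).1 (entryPos (a, b, c) (a + i)).2 = M 0 1 := by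
    intro i hi
    simp [entryPos, Finset.mem_range.mp hi]
  have h3 : ∀ i ∈ Finset.range c,
      M (entryPos (a, b, c) (a + b + i)).1 (entryPos (a, b, c) (a + b + i)).2 = M 1 0 := by
    intro i hi
    simp [entryPos, Finset.mem_range.mp hi, add_assoc]
  have h4 : ∀ i ∈ Finset.range l,
      M (entryPos (a, b, c) (a + b + c + i)).1 (entryPos (a, b, c) (a + b + c + i)).2 = 1 := by
    intro i _
    simp [entryPos, add_assoc, h]
  rw [Finset.prod_congr rfl h1, Finset.prod_congr rfl h2, Finset.prod_congr rfl h3,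
    Finset.prod_congr rfl h4]
  simp

/-- Distinct monomials in `x, y, z` are linearly independent as functions on `x - y z ≠ 0`. -/
theorem coeff_eq_zero_of_forall_det_ne_zero {d : ℕ} (c : TruncIndex d → ℚ)
    (h : ∀ x y z : ℚ, x - y * z ≠ 0 →
      ∑ t, c t * (x ^ t.1.1 * y ^ t.1.2.1 * z ^ t.1.2.2) = 0) (t : TruncIndex d) : c t = 0 := by
  classical
  let s : TruncIndex d → Fin 3 →₀ ℕ := fun t =>
    Finsupp.equivFunOnFinite.symm ![t.1.1, t.1.2.1, t.1.2.2]
  have hs : Function.Injective s := by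
    rintro ⟨⟨a, b, c⟩, _⟩ ⟨⟨a', b', c'⟩, _⟩ h
    have h := Finsupp.equivFunOnFinite.symm.injective h
    have h0 := congrFun h 0
    have h1 := congrFun h 1
    have h2 := congrFun h 2
    simp at h0 h1 h2
    subst h0 h1 h2
    rfl
  let P : MvPolynomial (Fin 3) ℚ := ∑ t, MvPolynomial.monomial (s t) (c t)
  let D : MvPolynomial (Fin 3) ℚ :=
    MvPolynomial.X 0 - MvPolynomial.X 1 * MvPolynomial.X 2
  -- Multiplying by the determinant polynomial extends the vanishing from the locus `D ≠ 0` to all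
  -- rational points.
  have hPD : P * D = 0 := by
    refine MvPolynomial.funext fun v => ?_
    rw [map_mul, map_zero, mul_eq_zero, or_iff_not_imp_right]
    intro hD
    have := h (v 0) (v 1) (v 2) (by simpa [D] using hD)
    rw [← this, map_sum]
    refine Finset.sum_congr rfl fun t _ => ?_
    rw [MvPolynomial.eval_monomial, Finsupp.prod_fintype _ _ (fun _ => pow_zero _)]
    simp [Fin.prod_univ_three, s]
  have hD : D ≠ 0 := by
    intro h0
    have := congrArg (MvPolynomial.eval ![1, 0, 0]) h0
    simp [D] at this
  have hP : P = 0 := (mul_eq_zero.mp hPD).resolve_right hD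
  have := congrArg (MvPolynomial.coeff (s t)) hP
  simpa [P, MvPolynomial.coeff_sum, MvPolynomial.coeff_monomial, hs.eq_iff] using this

theorem tensorPow_mem_schurAlgebra (d : ℕ) {M : Matrix (Fin 2) (Fin 2) ℚ} (hM : M.det ≠ 0) :
    tensorPow d M ∈ schurAlgebra d :=
  ⟨MonoidAlgebra.single (Matrix.GeneralLinearGroup.mkOfDetNeZero M hM) 1,
    (Representation.asAlgebraHom_single_one _ _).trans rfl⟩

/-- The truncated index set bounds the dimension of the Schur algebra from below. -/
theorem card_truncIndex_le_finrank (d : ℕ) :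
    Fintype.card (TruncIndex d) ≤ Module.finrank ℚ (schurAlgebra d) := by
  -- Independence is shown for functionals in the dual of `S(2,d)`, tested on the operators of the
  -- matrices with rows `(x, y)` and `(z, 1)`.
  have hli : LinearIndependent ℚ fun t : TruncIndex d =>
      ((matrixCoeff d (fun i => (entryPos t i).1) (fun i => (entryPos t i).2)).domRestrict
        (Subalgebra.toSubmodule (schurAlgebra d)) :
          Module.Dual ℚ (Subalgebra.toSubmodule (schurAlgebra d))) := by
    rw [Fintype.linearIndependent_iff]
    intro c hc
    refine coeff_eq_zero_of_forall_det_ne_zero c fun x y z hxyz => ?_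
    have hdet : (!![x, y; z, 1] : Matrix (Fin 2) (Fin 2) ℚ).det ≠ 0 := by
      simpa [Matrix.det_fin_two] using hxyz
    have := LinearMap.congr_fun hc ⟨_, tensorPow_mem_schurAlgebra d hdet⟩
    rw [LinearMap.sum_apply, LinearMap.zero_apply] at this
    rw [← this]
    refine Finset.sum_congr rfl fun t _ => ?_
    rw [LinearMap.smul_apply, LinearMap.domRestrict_apply, matrixCoeff_tensorPow,
      prod_entryPos t _ (by simp)]
    simp
  have := hli.fintype_card_le_finrank
  exact this.trans_eq (Subspace.dual_finrank_eq (K := ℚ) (V := schurAlgebra d))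

/-! ### Comparison of dimensions -/

/-- An algebra over the Schur algebra that is spanned by a family indexed by `TruncIndex d` is
isomorphic to it, and the family is a basis. -/
theorem exists_equiv_schurAlgebra {d : ℕ} {A : Type} [Ring A] [Algebra ℚ A]
    (π : A →ₐ[ℚ] Module.End ℚ (TensorSpace d)) (m : TruncIndex d → A)
    (hm : Submodule.span ℚ (Set.range m) = ⊤) (hS : schurAlgebra d ≤ π.range) :
    (∃ φ : A ≃ₐ[ℚ] schurAlgebra d, ∀ a, (φ a : Module.End ℚ (TensorSpace d)) = π a) ∧
    (∃ β : Module.Basis (TruncIndex d) ℚ A, ∀ t, β t = m t) ∧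
    ∃ β : Module.Basis (TruncIndex d) ℚ (schurAlgebra d),
      ∀ t, (β t : Module.End ℚ (TensorSpace d)) = π (m t) := by
  have : Module.Finite ℚ A :=
    ⟨Submodule.fg_def.mpr ⟨_, Set.finite_range m, hm⟩⟩
  have h1 : Module.finrank ℚ A ≤ Fintype.card (TruncIndex d) := by
    have := finrank_range_le_card (R := ℚ) m
    rwa [Set.finrank, hm, finrank_top] at this
  have h2 := card_truncIndex_le_finrank d
  have hS' : Subalgebra.toSubmodule (schurAlgebra d) ≤ LinearMap.range π.toLinearMap := hS
  have h3 : Module.finrank ℚ (schurAlgebra d)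
      ≤ Module.finrank ℚ (LinearMap.range π.toLinearMap) := Submodule.finrank_mono hS'
  have h4 := LinearMap.finrank_range_add_finrank_ker π.toLinearMap
  -- By `h1`, `h2`, `h3` the image already has dimension at least `dim A`, so rank-nullity leaves no
  -- room for a kernel.
  have hinj : Function.Injective π := by
    have : LinearMap.ker π.toLinearMap = ⊥ := Submodule.finrank_eq_zero.mp (by omega)
    exact LinearMap.ker_eq_bot.mp this
  have hrange : π.range = schurAlgebra d := by
    have := Submodule.eq_of_le_of_finrank_le hS' (by
      change _ ≤ Module.finrank ℚ (schurAlgebra d)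
      omega)
    exact le_antisymm (fun x hx => this.ge hx) hS
  let φ : A ≃ₐ[ℚ] schurAlgebra d :=
    (AlgEquiv.ofInjective π hinj).trans (Subalgebra.equivOfEq _ _ hrange)
  have hφ : ∀ a, (φ a : Module.End ℚ (TensorSpace d)) = π a := fun a => rfl
  let β := basisOfTopLeSpanOfCardEqFinrank m hm.ge (by omega)
  have hβ : ∀ t, β t = m t := fun t => by simp [β]
  refine ⟨⟨φ, hφ⟩, ⟨β, hβ⟩, β.map φ.toLinearEquiv, fun t => ?_⟩
  rw [Module.Basis.map_apply, hβ]
  exact hφ _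

/-! ### The presented algebras, their symmetry and their representations -/

theorem adjoin_range_mkAlgHom_ι {X : Type} (r : FreeAlgebra ℚ X → FreeAlgebra ℚ X → Prop) :
    Algebra.adjoin ℚ (Set.range fun x => RingQuot.mkAlgHom ℚ r (FreeAlgebra.ι ℚ x)) = ⊤ := by
  have h := congrArg (Subalgebra.map (RingQuot.mkAlgHom ℚ r)) (FreeAlgebra.adjoin_range_ι ℚ X)
  rw [AlgHom.map_adjoin, ← Set.range_comp, Algebra.map_top] at h
  exact h.trans (AlgHom.range_eq_top _ |>.mpr (RingQuot.mkAlgHom_surjective ℚ r))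

theorem adjoin_genA (d : ℕ) :
    Algebra.adjoin ℚ {genA d .e, genA d .H₁, genA d .f} = ⊤ := by
  rw [← adjoin_range_mkAlgHom_ι (Rel₃ d)]
  congr 1
  ext y
  constructor
  · rintro (rfl | rfl | rfl)
    exacts [⟨_, rfl⟩, ⟨_, rfl⟩, ⟨_, rfl⟩]
  · rintro ⟨_ | _ | _, rfl⟩
    exacts [Or.inl rfl, Or.inr (Or.inr rfl), Or.inr (Or.inl rfl)]

theorem isSchurTriple_genA (d : ℕ) :
    IsSchurTriple d (genA d .e) (genA d .H₁) (genA d .f) where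
  H_e := by simpa [genA] using RingQuot.mkAlgHom_rel ℚ (Rel₃.H₁_e (d := d))
  e_f := by simpa [genA, two_mul] using RingQuot.mkAlgHom_rel ℚ (Rel₃.e_f (d := d))
  H_f := by simpa [genA] using RingQuot.mkAlgHom_rel ℚ (Rel₃.H₁_f (d := d))
  fallingProd_eq_zero := by
    have := RingQuot.mkAlgHom_rel ℚ (Rel₃.minpoly (d := d))
    rw [map_zero] at this
    exact (map_fallingProd (RingQuot.mkAlgHom ℚ (Rel₃ d)).toRingHom d _).symm.trans this

theorem genB_H₁_add_genB_H₂ (d : ℕ) : genB d .H₁ + genB d .H₂ = (d : PresB d) := by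
  simpa [genB] using RingQuot.mkAlgHom_rel ℚ (Rel₄.sum (d := d))

theorem genB_H₂_eq (d : ℕ) : genB d .H₂ = (d : PresB d) - genB d .H₁ :=
  eq_sub_of_add_eq' (genB_H₁_add_genB_H₂ d)

theorem isSchurTriple_genB (d : ℕ) :
    IsSchurTriple d (genB d .e) (genB d .H₁) (genB d .f) where
  H_e := by simpa [genB] using RingQuot.mkAlgHom_rel ℚ (Rel₄.H₁_e (d := d))
  e_f := by
    rw [← genB_H₁_add_genB_H₂, two_mul, add_sub_add_left_eq_sub]
    simpa [genB] using RingQuot.mkAlgHom_rel ℚ (Rel₄.e_f (d := d))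
  H_f := by simpa [genB] using RingQuot.mkAlgHom_rel ℚ (Rel₄.H₁_f (d := d))
  fallingProd_eq_zero := by
    have := RingQuot.mkAlgHom_rel ℚ (Rel₄.minpoly (d := d))
    rw [map_zero] at this
    exact (map_fallingProd (RingQuot.mkAlgHom ℚ (Rel₄ d)).toRingHom d _).symm.trans this

theorem fallingProd_eq_prod {R : Type} [CommRing R] (d : ℕ) (T : R) :
    fallingProd d T = ∏ k ∈ Finset.range (d + 1), (T - k) := by
  induction d with
  | zero => simp [fallingProd]
  | succ d ih => rw [fallingProd_succ, ih, ← Finset.prod_range_succ]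

/-- The reflection `T ↦ d - T` permutes the factors up to sign: `(d - T) - k = -(T - (d - k))`.
Hence `H₂ = d - H₁` satisfies the same polynomial as `H₁`. -/
theorem fallingProd_natCast_sub {R : Type} [CommRing R] (d : ℕ) (T : R) :
    fallingProd d ((d : R) - T) = (-1) ^ (d + 1) * fallingProd d T := by
  rw [fallingProd_eq_prod, fallingProd_eq_prod, ← Finset.prod_range_reflect]
  have : (-1 : R) ^ (d + 1) = ∏ _k ∈ Finset.range (d + 1), (-1 : R) := by simp
  rw [this, ← Finset.prod_mul_distrib]
  refine Finset.prod_congr rfl fun k hk => ?_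
  rw [Finset.mem_range] at hk
  rw [show d + 1 - 1 - k = d - k by omega, Nat.cast_sub (by omega)]
  ring

/-- The relations are symmetric under exchanging `e` with `f` and `H` with `d - H`. -/
theorem IsSchurTriple.swap {A : Type} [Ring A] [Algebra ℚ A] {d : ℕ} {e H f : A}
    (h : IsSchurTriple d e H f) : IsSchurTriple d f ((d : A) - H) e where
  H_e := by
    rw [sub_mul, mul_sub, (Nat.cast_commute d f).eq, sub_sub_sub_cancel_left, ← neg_sub, h.H_f,
      neg_neg]
  e_f := by
    rw [← neg_sub, h.e_f, mul_sub, two_mul (d : A)]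
    abel
  H_f := by
    rw [sub_mul, mul_sub, (Nat.cast_commute d e).eq, sub_sub_sub_cancel_left, ← neg_sub, h.H_e]
  fallingProd_eq_zero := by
    -- The reflection identity needs commutativity, so it is taken in `ℚ[X]` and evaluated at `H`.
    have h1 := congrArg (Polynomial.aeval H)
      (fallingProd_natCast_sub d (Polynomial.X : Polynomial ℚ))
    have h2 := map_fallingProd (Polynomial.aeval H : Polynomial ℚ →ₐ[ℚ] A).toRingHom d
      ((d : Polynomial ℚ) - Polynomial.X)
    rw [map_mul, aeval_fallingProd, h.fallingProd_eq_zero, mul_zero] at h1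
    have h3 : (Polynomial.aeval H : Polynomial ℚ →ₐ[ℚ] A).toRingHom
        ((d : Polynomial ℚ) - Polynomial.X) = (d : A) - H := by simp
    rw [h3] at h2
    exact h2.symm.trans h1

theorem adjoin_genB (d : ℕ) :
    Algebra.adjoin ℚ {genB d .e, genB d .H₁, genB d .f} = ⊤ := by
  refine eq_top_iff.mpr ((adjoin_range_mkAlgHom_ι (Rel₄ d)).ge.trans (Algebra.adjoin_le ?_))
  have hH : genB d .H₁ ∈ Algebra.adjoin ℚ {genB d .e, genB d .H₁, genB d .f} :=
    Algebra.subset_adjoin (by simp)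
  rintro _ ⟨_ | _ | _ | _, rfl⟩
  · exact Algebra.subset_adjoin (Or.inl rfl)
  · exact Algebra.subset_adjoin (Or.inr (Or.inr rfl))
  · exact hH
  · change genB d .H₂ ∈ _
    rw [genB_H₂_eq]
    exact sub_mem (natCast_mem _ d) hH

theorem adjoin_genB_swap (d : ℕ) :
    Algebra.adjoin ℚ {genB d .f, genB d .H₂, genB d .e} = ⊤ := by
  refine eq_top_iff.mpr ((adjoin_genB d).ge.trans (Algebra.adjoin_le ?_))
  rintro _ (rfl | rfl | rfl)
  · exact Algebra.subset_adjoin (by simp)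
  · rw [eq_sub_of_add_eq (genB_H₁_add_genB_H₂ d)]
    exact sub_mem (natCast_mem _ d) (Algebra.subset_adjoin (by simp))
  · exact Algebra.subset_adjoin (by simp)

/-- The images of the generators of `PresA d` on tensor space. -/
def rhoGen₃ (d : ℕ) : Gen₃ → Module.End ℚ (TensorSpace d)
  | .e => rho d matE
  | .f => rho d matF
  | .H₁ => rho d matH₁

/-- The images of the generators of `PresB d` on tensor space. -/
def rhoGen₄ (d : ℕ) : Gen₄ → Module.End ℚ (TensorSpace d)
  | .e => rho d matE
  | .f => rho d matF
  | .H₁ => rho d matH₁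
  | .H₂ => rho d matH₂

theorem lift_fallingProd {X : Type} {A : Type} [Ring A] [Algebra ℚ A] (g : X → A) (d : ℕ) (x : X) :
    FreeAlgebra.lift ℚ g (fallingProd d (FreeAlgebra.ι ℚ x)) = fallingProd d (g x) := by
  have := map_fallingProd (FreeAlgebra.lift ℚ g).toRingHom d (FreeAlgebra.ι ℚ x)
  simpa using this

/-- The representation of `PresA d` on tensor space. -/
def reprA (d : ℕ) : PresA d →ₐ[ℚ] Module.End ℚ (TensorSpace d) :=
  RingQuot.liftAlgHom ℚ ⟨FreeAlgebra.lift ℚ (rhoGen₃ d), fun x y hxy => by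
    have h := isSchurTriple_rho d
    cases hxy with
    | H₁_e => simpa [rhoGen₃] using h.H_e
    | e_f => simpa [rhoGen₃, two_mul] using h.e_f
    | H₁_f => simpa [rhoGen₃] using h.H_f
    | minpoly => rw [lift_fallingProd, map_zero]; exact h.fallingProd_eq_zero⟩

/-- The representation of `PresB d` on tensor space. -/
def reprB (d : ℕ) : PresB d →ₐ[ℚ] Module.End ℚ (TensorSpace d) :=
  RingQuot.liftAlgHom ℚ ⟨FreeAlgebra.lift ℚ (rhoGen₄ d), fun x y hxy => by
    have h := isSchurTriple_rho d
    have hsum := rho_matH₁_add_rho_matH₂ d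
    have hH₂ := eq_sub_of_add_eq' hsum
    -- Since `H₂ = d - H₁`, the swapped triple supplies the relations of `H₂` with `e` and `f`.
    have h' := h.swap
    rw [← hH₂] at h'
    cases hxy with
    | H₁_H₂ =>
      have : Commute (rho d matH₁) (rho d matH₂) := by
        rw [hH₂]
        exact (Nat.commute_cast _ _).sub_right (Commute.refl _)
      simpa [rhoGen₄] using this.eq
    | H₁_e => simpa [rhoGen₄] using h.H_e
    | H₁_f => simpa [rhoGen₄] using h.H_f
    | H₂_e => simpa [rhoGen₄] using h'.H_f
    | H₂_f => simpa [rhoGen₄] using h'.H_e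
    | e_f =>
      have := h.e_f
      rw [← hsum, two_mul, add_sub_add_left_eq_sub] at this
      simpa [rhoGen₄] using this
    | sum => simpa [rhoGen₄] using hsum
    | minpoly => rw [lift_fallingProd, map_zero]; exact h.fallingProd_eq_zero⟩

theorem reprA_genA (d : ℕ) (x : Gen₃) : reprA d (genA d x) = rhoGen₃ d x :=
  (RingQuot.liftAlgHom_mkAlgHom_apply ℚ _ _ _).trans (FreeAlgebra.lift_ι_apply _ _)

theorem reprB_genB (d : ℕ) (x : Gen₄) : reprB d (genB d x) = rhoGen₄ d x :=
  (RingQuot.liftAlgHom_mkAlgHom_apply ℚ _ _ _).trans (FreeAlgebra.lift_ι_apply _ _)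

theorem map_mono {A B : Type} [Ring A] [Ring B] [Algebra ℚ A] [Algebra ℚ B] (π : A →ₐ[ℚ] B)
    (x y z : A) (t : ℕ × ℕ × ℕ) : π (mono x y z t) = mono (π x) (π y) (π z) t := by
  simp [mono]

end

end SchurTwo

open SchurTwo

theorem mainTheorem2 (d : ℕ) :
    -- the three-generator presentation of `S(2,d)`
    (∃ φ : SchurTwo.PresA d ≃ₐ[ℚ] SchurTwo.schurAlgebra d,
      (φ (SchurTwo.genA d .e) : Module.End ℚ (SchurTwo.TensorSpace d))
        = SchurTwo.rho d SchurTwo.matE ∧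
      (φ (SchurTwo.genA d .f) : Module.End ℚ (SchurTwo.TensorSpace d))
        = SchurTwo.rho d SchurTwo.matF ∧
      (φ (SchurTwo.genA d .H₁) : Module.End ℚ (SchurTwo.TensorSpace d))
        = SchurTwo.rho d SchurTwo.matH₁) ∧
    -- its truncated PBW basis
    (∃ β : Module.Basis (SchurTwo.TruncIndex d) ℚ (SchurTwo.PresA d), ∀ t,
      β t = SchurTwo.mono (SchurTwo.genA d .e) (SchurTwo.genA d .H₁) (SchurTwo.genA d .f) t) ∧
    -- the four-generator presentation of `S(2,d)`
    (∃ ψ : SchurTwo.PresB d ≃ₐ[ℚ] SchurTwo.schurAlgebra d,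
      (ψ (SchurTwo.genB d .e) : Module.End ℚ (SchurTwo.TensorSpace d))
        = SchurTwo.rho d SchurTwo.matE ∧
      (ψ (SchurTwo.genB d .f) : Module.End ℚ (SchurTwo.TensorSpace d))
        = SchurTwo.rho d SchurTwo.matF ∧
      (ψ (SchurTwo.genB d .H₁) : Module.End ℚ (SchurTwo.TensorSpace d))
        = SchurTwo.rho d SchurTwo.matH₁ ∧
      (ψ (SchurTwo.genB d .H₂) : Module.End ℚ (SchurTwo.TensorSpace d))
        = SchurTwo.rho d SchurTwo.matH₂) ∧
    -- its two truncated PBW bases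
    (∃ β : Module.Basis (SchurTwo.TruncIndex d) ℚ (SchurTwo.PresB d), ∀ t,
      β t = SchurTwo.mono (SchurTwo.genB d .e) (SchurTwo.genB d .H₁) (SchurTwo.genB d .f) t) ∧
    (∃ β : Module.Basis (SchurTwo.TruncIndex d) ℚ (SchurTwo.PresB d), ∀ t,
      β t = SchurTwo.mono (SchurTwo.genB d .f) (SchurTwo.genB d .H₂) (SchurTwo.genB d .e) t) ∧
    -- the same two bases inside `S(2,d) ⊆ End(E^{⊗ d})`
    (∃ β : Module.Basis (SchurTwo.TruncIndex d) ℚ (SchurTwo.schurAlgebra d), ∀ t,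
      (β t : Module.End ℚ (SchurTwo.TensorSpace d))
        = SchurTwo.mono (SchurTwo.rho d SchurTwo.matE) (SchurTwo.rho d SchurTwo.matH₁)
            (SchurTwo.rho d SchurTwo.matF) t) ∧
    (∃ β : Module.Basis (SchurTwo.TruncIndex d) ℚ (SchurTwo.schurAlgebra d), ∀ t,
      (β t : Module.End ℚ (SchurTwo.TensorSpace d))
        = SchurTwo.mono (SchurTwo.rho d SchurTwo.matF) (SchurTwo.rho d SchurTwo.matH₂)
            (SchurTwo.rho d SchurTwo.matE) t) := by
  have hSA : schurAlgebra d ≤ (reprA d).range :=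
    schurAlgebra_le d _ ⟨_, reprA_genA d .e⟩ ⟨_, reprA_genA d .f⟩ ⟨_, reprA_genA d .H₁⟩
  have hSB : schurAlgebra d ≤ (reprB d).range :=
    schurAlgebra_le d _ ⟨_, reprB_genB d .e⟩ ⟨_, reprB_genB d .f⟩ ⟨_, reprB_genB d .H₁⟩
  -- The same spanning theorem, applied to the triple `f, H₂, e`, yields the second basis.
  have hswap := (isSchurTriple_genB d).swap
  rw [← genB_H₂_eq] at hswap
  obtain ⟨⟨φ, hφ⟩, hA, -⟩ := exists_equiv_schurAlgebra (reprA d) _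
    ((isSchurTriple_genA d).span_mono_eq_top (adjoin_genA d)) hSA
  obtain ⟨⟨ψ, hψ⟩, hB, β, hβ⟩ := exists_equiv_schurAlgebra (reprB d) _
    ((isSchurTriple_genB d).span_mono_eq_top (adjoin_genB d)) hSB
  obtain ⟨-, hB', β', hβ'⟩ := exists_equiv_schurAlgebra (reprB d) _
    (hswap.span_mono_eq_top (adjoin_genB_swap d)) hSB
  refine ⟨⟨φ, ?_, ?_, ?_⟩, hA, ⟨ψ, ?_, ?_, ?_, ?_⟩, hB, hB', ⟨β, fun t => ?_⟩,
    ⟨β', fun t => ?_⟩⟩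
  · rw [hφ, reprA_genA]; rfl
  · rw [hφ, reprA_genA]; rfl
  · rw [hφ, reprA_genA]; rfl
  · rw [hψ, reprB_genB]; rfl
  · rw [hψ, reprB_genB]; rfl
  · rw [hψ, reprB_genB]; rfl
  · rw [hψ, reprB_genB]; rfl
  · rw [hβ, map_mono, reprB_genB, reprB_genB, reprB_genB]; rfl
  · rw [hβ', map_mono, reprB_genB, reprB_genB, reprB_genB]; rfl
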